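/- **Definitions.** For $A\subseteq[\omega]^{<\omega}$ the base of $A$ is $\bigcup A$. A *barrier* is an infinite set $B\subseteq[\omega]^{<\omega}$ of finite subsets of $\omega$ that is an antichain under $\subseteq$ and such that every infinite subset of its base has an initial segment belonging to $B$. Every barrier is well-ordered by the lexicographic order (sets being read as increasing sequences); its order type is called the *type* of the barrier. For $r,s\in[\omega]^{<\omega}$ with $r\neq\emptyset$, write $r\triangleleft s$ if $\min r<\min s$ and $r\setminus\{\min r\}$ is a proper initial segment of $s$. Let $P$ be a poset. A map $f:B\to P$ on a barrier $B$ is *good* if $f(s)\le_P f(t)$ for some $s,t\in B$ with $s\triangleleft t$. For a countable ordinal $\alpha$, $P$ is *$\alpha$-wqo* if for every barrier $B$ of type $\le\alpha$ every map $f:B\to P$ is good; $P$ is *bqo* if it is $\alpha$-wqo for all $\alpha<\omega_1$; $P$ is *$\sigma$-bqo* if it is a well quasi order (no infinite antichain and no infinite strictly decreasing sequence) and $P=\bigcup_{n<\omega}P_n$ for some subsets $P_n$ each of which is bqo in the induced order. Let $(I,\le_I)$ be a poset and, for each $i\in I$, let $(P_i,\le_i)$ be a poset with least element $0_i$. The *Dress–Schiffels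 product* $\bigotimes^{DS}_{i\in I}P_i$ is the set of all $f\in\prod_{i\in I}P_i$ whose support $\{i\in I: f(i)\ne 0_i\}$ is finite, ordered by: $f\le_{DS} g$ iff $f(i)<_i g(i)$ for every $i$ that is $\le_I$-maximal in $\{i\in I: f(i)\neq g(i)\}$. This is a partial order. **Theorem.** 1. If $I$ and all $P_i$ ($i\in I$) are bqo, then $\bigotimes^{DS}_{i\in I}P_i$ is bqo. 2. For every ordinal $\alpha\in[\omega,\omega_1)$: if $I$ and all $P_i$ ($i\in I$) are $\alpha$-wqo, then $\bigotimes^{DS}_{i\in I}P_i$ is $\alpha$-wqo. 3. If $I$ and all $P_i$ ($i\in I$) are $\sigma$-bqo, then $\bigotimes^{DS}_{i\in I}P_i$ is $\sigma$-bqo. -/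

import Mathlib

open scoped Ordinal

/-! ### Barriers -/

/-- The base of a family of finite sets of natural numbers: its union. -/
def barrierBase (B : Set (Finset ℕ)) : Set ℕ := {n | ∃ s ∈ B, n ∈ s}

/-- The finite set `s` is an initial segment of the set `X` of natural numbers. -/
def IsInitialSegment (s : Finset ℕ) (X : Set ℕ) : Prop :=
  (∀ x ∈ s, x ∈ X) ∧ ∀ x ∈ X, ∀ y ∈ s, x ≤ y → x ∈ s

/-- A barrier: an infinite family of finite sets of natural numbers, an antichain under inclusion,
such that every infinite subset of its base has an initial segment in the family. -/
structure IsBarrier (B : Set (Finset ℕ)) : Prop where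
  infinite : B.Infinite
  antichain : ∀ s ∈ B, ∀ t ∈ B, s ≠ t → ¬ s ⊆ t
  exists_initial : ∀ X : Set ℕ, X ⊆ barrierBase B → X.Infinite → ∃ s ∈ B, IsInitialSegment s X

/-- The shift-extension relation: `r` is nonempty, `min r < min s`, and `r` without its minimum is
a proper initial segment of `s`. -/
def ShiftExtends (r s : Finset ℕ) : Prop :=
  ∃ (hr : r.Nonempty) (hs : s.Nonempty), r.min' hr < s.min' hs ∧
    IsInitialSegment (r.erase (r.min' hr)) (s : Set ℕ) ∧ r.erase (r.min' hr) ≠ s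

/-- The lexicographic order on the members of a family of finite sets of natural numbers,
each set being read as the increasing list of its elements. -/
def barrierLex (B : Set (Finset ℕ)) (s t : B) : Prop :=
  List.Lex (· < ·) (s.1.sort (· ≤ ·)) (t.1.sort (· ≤ ·))

/-- Every nonempty part `T` of a barrier has a lexicographically minimal element. -/
theorem IsBarrier.exists_lex_min {B : Set (Finset ℕ)} (hB : IsBarrier B) (T : Set B)
    (hT : T.Nonempty) : ∃ m ∈ T, ∀ t ∈ T, ¬ barrierLex B t m := by
  by_contra! hno
  have hirr : ∀ t : B, ¬ barrierLex B t t := fun t h => lt_irrefl (t.1.sort (· ≤ ·)) h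
  have hsub : ∀ {s t : B}, s.1.sort (· ≤ ·) <+: t.1.sort (· ≤ ·) → s = t := by
    intro s t h
    by_contra hne
    refine hB.antichain _ s.2 _ t.2 (fun h' => hne (Subtype.ext h')) fun x hx => ?_
    exact (Finset.mem_sort (· ≤ ·)).1 (h.subset ((Finset.mem_sort (· ≤ ·)).2 hx))
  let Good : List ℕ → Prop := fun p =>
    (∃ t ∈ T, p <+: t.1.sort (· ≤ ·)) ∧
    ∀ t ∈ T, p <+: t.1.sort (· ≤ ·) → ∀ t' ∈ T, barrierLex B t' t → p <+: t'.1.sort (· ≤ ·)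
  have hstep : ∀ p, Good p → ∃ a, Good (p ++ [a]) := by
    classical
    rintro p ⟨⟨t, ht, hpt⟩, hlow⟩
    have hex : ∃ a, ∃ t ∈ T, p ++ [a] <+: t.1.sort (· ≤ ·) := by
      obtain ⟨l, hl⟩ := hpt
      cases l with
      | nil =>
        obtain ⟨t', ht', hlt⟩ := hno t ht
        have h1 := hlow t ht ⟨[], hl⟩ t' ht' hlt
        rw [List.append_nil] at hl
        rw [hl] at h1
        exact absurd hlt (hsub h1 ▸ hirr t)
      | cons a l => exact ⟨a, t, ht, l, by simpa using hl⟩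
    refine ⟨Nat.find hex, Nat.find_spec hex, ?_⟩
    rintro s hs ⟨l, hl⟩ s' hs' hlt
    obtain ⟨l', hl'⟩ := hlow s hs ⟨[Nat.find hex] ++ l, by simpa using hl⟩ s' hs' hlt
    cases l' with
    | nil =>
      have h1 : s'.1.sort (· ≤ ·) <+: s.1.sort (· ≤ ·) :=
        ⟨[Nat.find hex] ++ l, by rw [← hl', ← hl]; simp⟩
      exact absurd hlt (hsub h1 ▸ hirr s')
    | cons b l' =>
      have hb : Nat.find hex ≤ b := Nat.find_min' hex ⟨s', hs', l', by simpa using hl'⟩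
      have hlt' : p ++ (b :: l') < p ++ (Nat.find hex :: l) := by
        have h2 : s'.1.sort (· ≤ ·) < s.1.sort (· ≤ ·) := hlt
        rw [← hl', ← hl] at h2
        simpa using h2
      have hcancel : ∀ (q u v : List ℕ), q ++ u < q ++ v → u < v := by
        intro q u v h
        induction q with
        | nil => exact h
        | cons c q ih => exact ih (by simpa [List.cons_lt_cons_iff] using h)
      have hlt'' := hcancel _ _ _ hlt'
      rw [List.cons_lt_cons_iff] at hlt''
      have : b = Nat.find hex := by omega
      exact ⟨l', by rw [← hl', this]; simp⟩
  choose! a ha using hstep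
  let p : ℕ → List ℕ := fun n => Nat.rec [] (fun _ q => q ++ [a q]) n
  have hp : ∀ n, p (n + 1) = p n ++ [a (p n)] := fun n => rfl
  have hgood : ∀ n, Good (p n) := by
    intro n
    induction n with
    | zero => exact ⟨⟨hT.some, hT.some_mem, List.nil_prefix⟩, fun _ _ _ _ _ _ => List.nil_prefix⟩
    | succ n ih => exact ha _ ih
  have hmono : ∀ m n, m ≤ n → p m <+: p n := by
    intro m n h
    induction n, h using Nat.le_induction with
    | base => exact List.prefix_refl _
    | succ n _ ih => exact ih.trans ⟨[a (p n)], rfl⟩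
  have hlen : ∀ n, (p n).length = n := by
    intro n
    induction n with
    | zero => rfl
    | succ n ih => rw [hp]; simp [ih]
  have hnd : ∀ n, (p n).Nodup := by
    intro n
    obtain ⟨t, -, h⟩ := (hgood n).1
    exact (Finset.sort_nodup t.1 (· ≤ ·)).sublist h.sublist
  let X : Set ℕ := {x | ∃ n, x ∈ p n}
  have hXbase : X ⊆ barrierBase B := by
    rintro x ⟨n, hx⟩
    obtain ⟨t, -, h⟩ := (hgood n).1
    exact ⟨t.1, t.2, (Finset.mem_sort (· ≤ ·)).1 (h.subset hx)⟩
  have hXinf : X.Infinite := by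
    intro hfin
    have h1 : (p (hfin.toFinset.card + 1)).toFinset ⊆ hfin.toFinset := by
      intro x hx
      exact hfin.mem_toFinset.2 ⟨hfin.toFinset.card + 1, List.mem_toFinset.1 hx⟩
    have h2 := Finset.card_le_card h1
    rw [List.toFinset_card_of_nodup (hnd (hfin.toFinset.card + 1)),
      hlen (hfin.toFinset.card + 1)] at h2
    omega
  obtain ⟨s, hs, hsX, -⟩ := hB.exists_initial X hXbase hXinf
  have hN : ∃ N, ∀ x ∈ s, x ∈ p N := by
    choose! k hk using hsX
    exact ⟨s.sup k, fun x hx => (hmono _ _ (Finset.le_sup hx)).subset (hk x hx)⟩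
  obtain ⟨N, hN⟩ := hN
  have huniq : ∀ t ∈ T, p N <+: t.1.sort (· ≤ ·) → t = ⟨s, hs⟩ := by
    intro t _ h
    by_contra hne
    refine hB.antichain _ hs _ t.2 (fun h' => hne (Subtype.ext h'.symm)) fun x hx => ?_
    exact (Finset.mem_sort (· ≤ ·)).1 (h.subset (hN x hx))
  obtain ⟨⟨t, ht, hpt⟩, hlow⟩ := hgood N
  obtain ⟨t', ht', hlt⟩ := hno t ht
  have h1 := huniq t ht hpt
  have h2 := huniq t' ht' (hlow t ht hpt t' ht' hlt)
  rw [h1, h2] at hlt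
  exact hirr _ hlt

/-- A barrier is well-ordered by the lexicographic order. -/
theorem IsBarrier.isWellOrder {B : Set (Finset ℕ)} (hB : IsBarrier B) :
    IsWellOrder B (barrierLex B) := by
  have hinj : ∀ s t : B, s.1.sort (· ≤ ·) = t.1.sort (· ≤ ·) → s = t := by
    intro s t h
    apply Subtype.ext
    rw [← Finset.sort_toFinset s.1 (· ≤ ·), h, Finset.sort_toFinset]
  have hwf : WellFounded (barrierLex B) :=
    WellFounded.wellFounded_iff_has_min.2 fun T hT => hB.exists_lex_min T hT
  exact
    { wf := hwf
      trichotomous := fun s t h1 h2 =>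
        hinj s t (le_antisymm (not_lt.1 h2) (not_lt.1 h1)) }

/-- The type of a barrier: its order type under the lexicographic order. -/
noncomputable def IsBarrier.type {B : Set (Finset ℕ)} (hB : IsBarrier B) : Ordinal.{0} :=
  @Ordinal.type B (barrierLex B) hB.isWellOrder

/-! ### `α`-wqo, bqo and `σ`-bqo posets -/

/-- A map `f` from a barrier `B` to a poset is good if `f s ≤ f t` for some `s`, `t` in `B` such
that `t` shift-extends `s`. -/
def IsGoodArray {P : Type*} [PartialOrder P] (B : Set (Finset ℕ)) (f : B → P) : Prop :=
  ∃ s t : B, ShiftExtends s.1 t.1 ∧ f s ≤ f t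

/-- `P` is `α`-wqo: every map to `P` from a barrier of type at most `α` is good. -/
def IsAlphaWqo (α : Ordinal.{0}) (P : Type*) [PartialOrder P] : Prop :=
  ∀ (B : Set (Finset ℕ)) (hB : IsBarrier B), hB.type ≤ α → ∀ f : B → P, IsGoodArray B f

/-- `P` is bqo: it is `α`-wqo for every countable ordinal `α`. -/
def IsBqo (P : Type*) [PartialOrder P] : Prop :=
  ∀ α : Ordinal.{0}, α < ω₁ → IsAlphaWqo α P

/-- `P` is `σ`-bqo: it is a wqo and a countable union of subsets which are bqo in the induced
order. -/
def IsSigmaBqo (P : Type*) [PartialOrder P] : Prop :=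
  WellQuasiOrderedLE P ∧ ∃ S : ℕ → Set P, (⋃ n, S n) = Set.univ ∧ ∀ n, IsBqo (S n)

/-! ### The Dress–Schiffels product -/

/-- The universe of the Dress–Schiffels product: choice functions of finite support. -/
def DressSchiffels {I : Type*} (P : I → Type*) [∀ i, PartialOrder (P i)]
    [∀ i, OrderBot (P i)] : Type _ :=
  {f : ∀ i, P i // {i | f i ≠ ⊥}.Finite}

namespace DressSchiffels

variable {I : Type*} {P : I → Type*} [∀ i, PartialOrder (P i)] [∀ i, OrderBot (P i)]

/-- The set of indices at which `f` and `g` differ. -/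
def diff (f g : DressSchiffels P) : Set I := {i | f.1 i ≠ g.1 i}

theorem finite_diff (f g : DressSchiffels P) : (diff f g).Finite := by
  refine (f.2.union g.2).subset fun i hi => ?_
  by_contra h
  simp only [Set.mem_union, Set.mem_ofPred_eq, not_or, not_not] at h
  exact hi (h.1.trans h.2.symm)

variable [PartialOrder I]

/-- `f ≤ g` iff `f i < g i` for every maximal element `i` of `diff f g`. -/
instance : LE (DressSchiffels P) :=
  ⟨fun f g => ∀ i, Maximal (· ∈ diff f g) i → f.1 i < g.1 i⟩

theorem le_def (f g : DressSchiffels P) :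
    f ≤ g ↔ ∀ i, Maximal (· ∈ diff f g) i → f.1 i < g.1 i := Iff.rfl

protected theorem le_trans' (f g h : DressSchiffels P) (hfg : f ≤ g) (hgh : g ≤ h) : f ≤ h := by
  intro i hi
  have habove : ∀ j, i < j → f.1 j = h.1 j := by
    intro j hj
    by_contra hne
    exact absurd (hi.2 (y := j) hne hj.le) (not_le_of_gt hj)
  have hfgabove : ∀ j, i < j → f.1 j = g.1 j := by
    by_contra! hcon
    have hfin : {j | i < j ∧ j ∈ diff f g}.Finite :=
      (finite_diff f g).subset fun j hj => hj.2
    obtain ⟨j, hj⟩ := hfin.exists_maximal hcon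
    have h1 : f.1 j < g.1 j := hfg j ⟨hj.1.2, fun k hk hjk =>
      hj.2 (y := k) ⟨hj.1.1.trans_le hjk, hk⟩ hjk⟩
    have h2 : g.1 j < h.1 j := by
      refine hgh j ⟨?_, fun k hk hjk => hj.2 (y := k) ⟨hj.1.1.trans_le hjk, ?_⟩ hjk⟩
      · intro heq
        exact hj.1.2 ((habove j hj.1.1).trans heq.symm)
      · intro heq
        exact hk (heq.symm.trans (habove k (hj.1.1.trans_le hjk)))
    exact absurd (h1.trans h2) (by rw [habove j hj.1.1]; exact lt_irrefl _)
  have h1 : f.1 i ≤ g.1 i := by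
    by_cases heq : f.1 i = g.1 i
    · exact heq.le
    · refine (hfg i ⟨heq, fun k hk hik => ?_⟩).le
      rcases hik.lt_or_eq with hlt | rfl
      · exact absurd (hfgabove k hlt) hk
      · exact le_rfl
  have h2 : g.1 i ≤ h.1 i := by
    by_cases heq : g.1 i = h.1 i
    · exact heq.le
    · refine (hgh i ⟨heq, fun k hk hik => ?_⟩).le
      rcases hik.lt_or_eq with hlt | rfl
      · exact absurd ((hfgabove k hlt).symm.trans (habove k hlt)) hk
      · exact le_rfl
  exact lt_of_le_of_ne (h1.trans h2) hi.1

instance : PartialOrder (DressSchiffels P) where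
  le_refl f := fun i hi => absurd rfl hi.1
  le_trans := DressSchiffels.le_trans'
  le_antisymm f g hfg hgf := by
    apply Subtype.ext
    funext i
    by_contra hne
    obtain ⟨j, hj⟩ := (finite_diff f g).exists_maximal ⟨i, hne⟩
    have h1 : f.1 j < g.1 j := hfg j hj
    have h2 : g.1 j < f.1 j := hgf j
      ⟨fun h => hj.1 h.symm, fun k hk hjk => hj.2 (y := k) (fun h => hk h.symm) hjk⟩
    exact lt_asymm h1 h2

end DressSchiffels

/-!
The proof works along one fixed barrier `B`; "no bad arrays" (`IsWqoAlong`) refers to arrays on the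
restrictions of `B` to infinite subsets of its base. These restrictions are barriers of type at most
that of `B`, so shrinking the base never leaves the class of barriers under consideration, and each
of the three statements follows by letting `B` vary: over the barriers of type at most `α`, over all
barriers (all have countable type), and over the barrier of singletons, for which arrays are
sequences and "no bad arrays" means wqo.

Let `F` be a bad array in the product, and write `s ◁ t` if `t` shift-extends `s`. If `s ◁ t`, then
`F s ≰ F t` is witnessed by an index `i` above which `F s` and `F t` agree and at which
`F s i ≰ F t i`; in particular `i` lies in the finite support of `F s`. The choice of `i` is thus a
coloring with finitely many colors for each `s`, and a diagonal intersection over the Ramsey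
property of open sets makes `i = i s` depend on `s` alone (`IsBarrier.exists_uniform`). After two
more shrinkings, the relations `i s ≤ i t` and `i s = i t` hold for all pairs `s ◁ t` or for none
(`IsBarrier.exists_homogeneous_pairs`).

* If `i s ≤ i t` never holds, then `i` is a bad array in `I`.
* If `i s = i t` always holds, then `i` is constant, since any two members of a barrier are
  connected through `◁`, and `s ↦ F s i` is a bad array in `P i`.
* Otherwise `i s < i t` whenever `s ◁ t`. Along a chain `u 0 ◁ u 1 ◁ …` the elements `F (u 0)`, …,
  `F (u n)` agree at `i (u n)`, where `F (u n)` is nonzero. So the support of `F (u 0)` contains the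
  infinitely many indices `i (u n)`, a contradiction.

For the `σ`-bqo statement the argument is carried out for the elements of the product with support
in a subset `J` of `I` and nonzero values in subsets `Q i` of `P i`
(`DressSchiffels.isWqoAlong_restrict`). Taking for `J` and `Q i` the unions of the first `n` pieces
of the given decompositions, which are bqo by the Ramsey property again, these sets form a countable
cover, because supports are finite.
-/

/-! ### Initial segments and tails of infinite sets of natural numbers -/

theorem IsInitialSegment.subset_or_subset {s t : Finset ℕ} {X : Set ℕ}
    (hs : IsInitialSegment s X) (ht : IsInitialSegment t X) : s ⊆ t ∨ t ⊆ s := by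
  by_contra! h
  obtain ⟨⟨x, hxs, hxt⟩, y, hyt, hys⟩ := And.imp Finset.not_subset.1 Finset.not_subset.1 h
  rcases le_total x y with hxy | hxy
  · exact hxt (ht.2 x (hs.1 x hxs) y hyt hxy)
  · exact hys (hs.2 y (ht.1 y hyt) x hxs hxy)

theorem IsInitialSegment.union {s t : Finset ℕ} {X : Set ℕ}
    (hs : IsInitialSegment s X) (ht : IsInitialSegment t X) : IsInitialSegment (s ∪ t) X := by
  rcases hs.subset_or_subset ht with h | h
  · rwa [Finset.union_eq_right.2 h]
  · rwa [Finset.union_eq_left.2 h]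

/-- An initial segment `s` of `X` which is contained in a common initial segment `u` of `X` and `Z`
is an initial segment of `Z`. -/
theorem IsInitialSegment.transfer {s u : Finset ℕ} {X Z : Set ℕ} (hs : IsInitialSegment s X)
    (hsu : s ⊆ u) (hX : IsInitialSegment u X) (hZ : IsInitialSegment u Z) :
    IsInitialSegment s Z :=
  ⟨fun x hx => hZ.1 x (hsu hx), fun x hx y hy hxy =>
    hs.2 x (hX.1 x (hZ.2 x hx y (hsu hy) hxy)) y hy hxy⟩

/-- A set of natural numbers without its least element. -/
def setTail (X : Set ℕ) : Set ℕ := X \ {sInf X}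

theorem setTail_subset (X : Set ℕ) : setTail X ⊆ X := Set.sdiff_subset

theorem Set.Infinite.setTail {X : Set ℕ} (hX : X.Infinite) : (setTail X).Infinite :=
  hX.sdiff (Set.finite_singleton _)

theorem sInf_lt_of_mem_setTail {X : Set ℕ} {x : ℕ} (hx : x ∈ setTail X) : sInf X < x :=
  lt_of_le_of_ne (Nat.sInf_le hx.1) fun h => hx.2 h.symm

theorem sInf_eq_of_isInitialSegment {u : Finset ℕ} {X Z : Set ℕ} (hX : IsInitialSegment u X)
    (hZ : IsInitialSegment u Z) (hu : u.Nonempty) : sInf Z = sInf X := by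
  obtain ⟨a, ha⟩ := hu
  have key : ∀ {X Z : Set ℕ}, IsInitialSegment u X → IsInitialSegment u Z → sInf Z ≤ sInf X := by
    intro X Z hX hZ
    have h1 : sInf X ∈ X := Nat.sInf_mem ⟨a, hX.1 a ha⟩
    exact Nat.sInf_le (hZ.1 _ (hX.2 _ h1 a ha (Nat.sInf_le (hX.1 a ha))))
  exact le_antisymm (key hX hZ) (key hZ hX)

theorem Set.Infinite.inter_above {X : Set ℕ} (hX : X.Infinite) (s : Finset ℕ) :
    {y ∈ X | ∀ x ∈ s, x < y}.Infinite := by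
  refine (hX.sdiff (Set.finite_Iic (s.sup id))).mono fun y hy => ⟨hy.1, fun x hx => ?_⟩
  exact lt_of_le_of_lt (Finset.le_sup (f := id) hx) (not_le.1 hy.2)

/-! ### Diagonalization and the Ramsey property of open sets -/

/-- Diagonal intersection: a hereditary property `D s` of infinite sets which can be achieved by
shrinking, for each finite set `s` separately, can be achieved by one infinite set `Y` for all its
finite subsets `s` at once, on the part of `Y` above `s`. -/
theorem exists_diagonal {D : Finset ℕ → Set ℕ → Prop} {X : Set ℕ} (hX : X.Infinite)
    (mono : ∀ s Y Z, Z ⊆ Y → D s Y → D s Z)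
    (dense : ∀ s, ∀ Y ⊆ X, Y.Infinite → ∃ Z ⊆ Y, Z.Infinite ∧ D s Z) :
    ∃ Y ⊆ X, Y.Infinite ∧ ∀ s : Finset ℕ, ↑s ⊆ Y → D s {y ∈ Y | ∀ x ∈ s, x < y} := by
  have dense' : ∀ S : Finset (Finset ℕ), ∀ Y ⊆ X, Y.Infinite →
      ∃ Z ⊆ Y, Z.Infinite ∧ ∀ s ∈ S, D s Z := by
    intro S
    induction S using Finset.induction_on with
    | empty => exact fun Y _ hY => ⟨Y, subset_rfl, hY, by simp⟩
    | insert s S _ ih =>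
      intro Y hYX hY
      obtain ⟨Z, hZY, hZ, hZS⟩ := ih Y hYX hY
      obtain ⟨W, hWZ, hW, hWs⟩ := dense s Z (hZY.trans hYX) hZ
      refine ⟨W, hWZ.trans hZY, hW, fun t ht => ?_⟩
      rcases Finset.mem_insert.1 ht with rfl | ht
      · exact hWs
      · exact mono t Z W hWZ (hZS t ht)
  have step : ∀ Y : {Y : Set ℕ // Y ⊆ X ∧ Y.Infinite}, ∃ Z : {Y : Set ℕ // Y ⊆ X ∧ Y.Infinite},
      Z.1 ⊆ setTail Y.1 ∧ ∀ s ∈ (Finset.range (sInf Y.1 + 1)).powerset, D s Z.1 := by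
    intro Y
    obtain ⟨Z, hZY, hZ, hZS⟩ := dense' (Finset.range (sInf Y.1 + 1)).powerset (setTail Y.1)
      ((setTail_subset _).trans Y.2.1) Y.2.2.setTail
    exact ⟨⟨Z, hZY.trans ((setTail_subset _).trans Y.2.1), hZ⟩, hZY, hZS⟩
  choose g hg hgD using step
  obtain ⟨X₀, hX₀X, hX₀, hD₀⟩ := dense ∅ X subset_rfl hX
  -- `Y` consists of the least elements of the sets `A n`. For `s ⊆ Y` with maximum `min (A n)`, the
  -- part of `Y` above `s` lies in `A (n + 1)`, which was chosen with property `D s`.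
  let A : ℕ → {Y : Set ℕ // Y ⊆ X ∧ Y.Infinite} := fun n => g^[n] ⟨X₀, hX₀X, hX₀⟩
  have hA : ∀ n, A (n + 1) = g (A n) := fun n => Function.iterate_succ_apply' _ _ _
  have hanti : Antitone fun n => (A n).1 := antitone_nat_of_succ_le fun n => by
    change (A (n + 1)).1 ⊆ (A n).1
    rw [hA]
    exact (hg _).trans (setTail_subset _)
  have hmem : ∀ n, sInf (A n).1 ∈ (A n).1 := fun n => Nat.sInf_mem (A n).2.2.nonempty
  have hmono : StrictMono fun n => sInf (A n).1 := strictMono_nat_of_lt_succ fun n => by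
    have h := hmem (n + 1)
    rw [hA] at h ⊢
    exact sInf_lt_of_mem_setTail (hg _ h)
  refine ⟨Set.range fun n => sInf (A n).1, ?_, Set.infinite_range_of_injective hmono.injective, ?_⟩
  · rintro _ ⟨n, rfl⟩
    exact (A n).2.1 (hmem n)
  · intro s hs
    rcases s.eq_empty_or_nonempty with rfl | hne
    · refine mono _ X₀ _ ?_ hD₀
      rintro _ ⟨⟨n, rfl⟩, -⟩
      exact hanti (Nat.zero_le n) (hmem n)
    · obtain ⟨n, hn⟩ := hs (s.max'_mem hne)
      refine mono _ (A (n + 1)).1 _ ?_ ?_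
      · rintro _ ⟨⟨m, rfl⟩, hm⟩
        have h := hm _ (s.max'_mem hne)
        rw [← hn] at h
        exact hanti (hmono.lt_iff_lt.1 h) (hmem m)
      · rw [hA]
        refine hgD _ _ (Finset.mem_powerset.2 fun x hx => ?_)
        have h1 : x ≤ sInf (A n).1 := (s.le_max' x hx).trans_eq hn.symm
        exact Finset.mem_range.2 (Nat.lt_succ_of_le h1)

/-- `Y` accepts `s`: every infinite subset of `Y` above `s`, once `s` is put in front of it, has an
initial segment in `𝓕`. -/
def Accepts (𝓕 : Set (Finset ℕ)) (s : Finset ℕ) (Y : Set ℕ) : Prop :=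
  ∀ Z ⊆ Y, Z.Infinite → (∀ x ∈ s, ∀ z ∈ Z, x < z) → ∃ t ∈ 𝓕, IsInitialSegment t (↑s ∪ Z)

/-- `Y` rejects `s`: no infinite subset of `Y` accepts `s`. -/
def Rejects (𝓕 : Set (Finset ℕ)) (s : Finset ℕ) (Y : Set ℕ) : Prop :=
  ∀ Z ⊆ Y, Z.Infinite → ¬ Accepts 𝓕 s Z

theorem Accepts.mono {𝓕 : Set (Finset ℕ)} {s : Finset ℕ} {Y Z : Set ℕ} (h : Accepts 𝓕 s Y)
    (hZ : Z ⊆ Y) : Accepts 𝓕 s Z := fun W hW => h W (hW.trans hZ)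

theorem Rejects.mono {𝓕 : Set (Finset ℕ)} {s : Finset ℕ} {Y Z : Set ℕ} (h : Rejects 𝓕 s Y)
    (hZ : Z ⊆ Y) : Rejects 𝓕 s Z := fun W hW => h W (hW.trans hZ)

/-- Every infinite set has an infinite subset which accepts or rejects each of its finite
subsets. -/
theorem exists_decides (𝓕 : Set (Finset ℕ)) {X : Set ℕ} (hX : X.Infinite) :
    ∃ Y ⊆ X, Y.Infinite ∧ ∀ s : Finset ℕ, ↑s ⊆ Y → Accepts 𝓕 s Y ∨ Rejects 𝓕 s Y := by
  obtain ⟨Y, hYX, hY, hD⟩ := exists_diagonal (D := fun s Y => Accepts 𝓕 s Y ∨ Rejects 𝓕 s Y) hX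
    (fun s Y Z hZ h => h.imp (·.mono hZ) (·.mono hZ)) (by
      intro s Y _ hY
      by_cases h : Rejects 𝓕 s Y
      · exact ⟨Y, subset_rfl, hY, Or.inr h⟩
      · simp only [Rejects, not_forall, not_not] at h
        obtain ⟨Z, hZY, hZ, hacc⟩ := h
        exact ⟨Z, hZY, hZ, Or.inl hacc⟩)
  refine ⟨Y, hYX, hY, fun s hs => (hD s hs).imp ?_ ?_⟩
  · exact fun h Z hZY hZ hlt => h Z (fun z hz => ⟨hZY hz, fun x hx => hlt x hx z hz⟩) hZ hlt
  · exact fun h Z hZY hZ hacc => h _ (fun z hz => ⟨hZY hz.1, hz.2⟩) (hZ.inter_above s)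
      (hacc.mono fun z hz => hz.1)

/-- **Nash-Williams' theorem**: open sets are Ramsey. If the set `Y` which decides all its finite
subsets rejects `∅`, then rejection propagates, after thinning out `Y` once more, to all finite
subsets; but `Y` cannot reject a member of `𝓕`. -/
theorem exists_forall_initial_or_forall_notMem (𝓕 : Set (Finset ℕ)) {X : Set ℕ}
    (hX : X.Infinite) : ∃ Y ⊆ X, Y.Infinite ∧
      ((∀ Z ⊆ Y, Z.Infinite → ∃ t ∈ 𝓕, IsInitialSegment t Z) ∨
        ∀ s : Finset ℕ, ↑s ⊆ Y → s ∉ 𝓕) := by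
  obtain ⟨Y, hYX, hY, hdec⟩ := exists_decides 𝓕 hX
  rcases hdec ∅ (by simp) with hacc | hrej
  · refine ⟨Y, hYX, hY, Or.inl fun Z hZY hZ => ?_⟩
    simpa using hacc Z hZY hZ (by simp)
  obtain ⟨Y', hY'Y, hY', hD⟩ := exists_diagonal
    (D := fun s Z => ↑s ⊆ Y → Rejects 𝓕 s Y → ∀ n ∈ Z, (∀ x ∈ s, x < n) →
      Rejects 𝓕 (insert n s) Y) hY
    (fun s V Z hZ h hs hr n hn => h hs hr n (hZ hn)) (by
      intro s Z hZY hZ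
      by_cases hs : ↑s ⊆ Y ∧ Rejects 𝓕 s Y
      · let W : Set ℕ := {n ∈ Z | (∀ x ∈ s, x < n) ∧ ¬ Rejects 𝓕 (insert n s) Y}
        have hW : W.Finite := by
          by_contra hW
          -- An infinite `W` would accept `s`: split off the least element of a subset of `W`.
          refine hs.2 W (fun n hn => hZY hn.1) hW fun V hVW hV _ => ?_
          have hn := Nat.sInf_mem hV.nonempty
          have hins : (↑(insert (sInf V) s) : Set ℕ) ⊆ Y := by
            rw [Finset.coe_insert]
            exact Set.insert_subset (hZY (hVW hn).1) hs.1
          have hacc := (hdec _ hins).resolve_right (hVW hn).2.2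
          obtain ⟨t, ht, hinit⟩ := hacc (setTail V)
            (fun v hv => hZY (hVW hv.1).1) hV.setTail (by
              intro x hx z hz
              have h1 := sInf_lt_of_mem_setTail hz
              rcases Finset.mem_insert.1 hx with rfl | hx
              · exact h1
              · exact ((hVW hn).2.1 x hx).trans h1)
          refine ⟨t, ht, ?_⟩
          have heq : (↑(insert (sInf V) s) : Set ℕ) ∪ setTail V = ↑s ∪ V := by
            ext x
            by_cases hx : x = sInf V
            · simp [hx, hn]
            · simp [hx, setTail]
          rwa [heq] at hinit
        refine ⟨Z \ W, Set.sdiff_subset, hZ.sdiff hW, fun _ _ n hn hlt => ?_⟩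
        by_contra h
        exact hn.2 ⟨hn.1, hlt, h⟩
      · exact ⟨Z, subset_rfl, hZ, fun h1 h2 => absurd ⟨h1, h2⟩ hs⟩)
  have hall : ∀ s : Finset ℕ, ↑s ⊆ Y' → Rejects 𝓕 s Y := by
    intro s
    induction s using Finset.induction_on_max with
    | empty => exact fun _ => hrej
    | insert a s hlt ih =>
      intro h
      rw [Finset.coe_insert] at h
      have hs := (Set.subset_insert _ _).trans h
      exact hD s hs (hs.trans hY'Y) (ih hs) a ⟨h (Set.mem_insert _ _), hlt⟩ hlt
  refine ⟨Y', hY'Y.trans hYX, hY', Or.inr fun s hs hsF => ?_⟩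
  refine hall s hs Y subset_rfl hY fun Z _ _ hlt => ⟨s, hsF, fun x hx => Or.inl hx, ?_⟩
  rintro x (hx | hx) y hy hxy
  · exact hx
  · exact absurd hxy (not_le.2 (hlt y hy x hx))

/-- A coloring `c` of sets of natural numbers is locally constant on `A`: the color of an infinite
subset of `A` is determined by one of its finite initial segments. -/
def LocConst {κ : Type*} (A : Set ℕ) (c : Set ℕ → κ) : Prop :=
  ∀ X ⊆ A, X.Infinite → ∃ u : Finset ℕ, IsInitialSegment u X ∧
    ∀ Z ⊆ A, Z.Infinite → IsInitialSegment u Z → c Z = c X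

theorem LocConst.mono {κ : Type*} {A A' : Set ℕ} {c : Set ℕ → κ} (hc : LocConst A c)
    (h : A' ⊆ A) : LocConst A' c := fun X hXA hX =>
  let ⟨u, hu, hcu⟩ := hc X (hXA.trans h) hX
  ⟨u, hu, fun Z hZ => hcu Z (hZ.trans h)⟩

theorem LocConst.comp {κ ι : Type*} {A : Set ℕ} {c : Set ℕ → κ} (hc : LocConst A c) (f : κ → ι) :
    LocConst A fun X => f (c X) := fun X hXA hX =>
  let ⟨u, hu, hcu⟩ := hc X hXA hX
  ⟨u, hu, fun Z hZA hZ hi => congrArg f (hcu Z hZA hZ hi)⟩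

theorem LocConst.prodMk {κ ι : Type*} {A : Set ℕ} {c : Set ℕ → κ} {d : Set ℕ → ι}
    (hc : LocConst A c) (hd : LocConst A d) : LocConst A fun X => (c X, d X) := by
  intro X hXA hX
  obtain ⟨u, hu, hcu⟩ := hc X hXA hX
  obtain ⟨v, hv, hdv⟩ := hd X hXA hX
  refine ⟨u ∪ v, hu.union hv, fun Z hZA hZ hi => Prod.ext ?_ ?_⟩
  · exact hcu Z hZA hZ (hu.transfer Finset.subset_union_left (hu.union hv) hi)
  · exact hdv Z hZA hZ (hv.transfer Finset.subset_union_right (hu.union hv) hi)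

theorem LocConst.setTail {κ : Type*} {A : Set ℕ} {c : Set ℕ → κ} (hc : LocConst A c) :
    LocConst A fun X => c (setTail X) := by
  intro X hXA hX
  obtain ⟨u, hu, hcu⟩ := hc _ ((setTail_subset X).trans hXA) hX.setTail
  have hmem := Nat.sInf_mem hX.nonempty
  have hu' : IsInitialSegment (insert (sInf X) u) X := by
    refine ⟨fun x hx => ?_, fun x hx y hy hxy => ?_⟩
    · rcases Finset.mem_insert.1 hx with rfl | hx
      · exact hmem
      · exact (hu.1 x hx).1
    · by_cases h : x = sInf X
      · exact h ▸ Finset.mem_insert_self _ _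
      · refine Finset.mem_insert_of_mem ?_
        rcases Finset.mem_insert.1 hy with rfl | hy
        · exact absurd (le_antisymm hxy (Nat.sInf_le hx)) h
        · exact hu.2 x ⟨hx, h⟩ y hy hxy
  refine ⟨_, hu', fun Z hZA hZ hi => hcu _ ((setTail_subset Z).trans hZA) hZ.setTail ?_⟩
  have hinf := sInf_eq_of_isInitialSegment hu' hi (Finset.insert_nonempty _ _)
  refine ⟨fun x hx => ⟨hi.1 x (Finset.mem_insert_of_mem hx), ?_⟩, fun x hx y hy hxy => ?_⟩
  · rw [hinf]
    exact (hu.1 x hx).2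
  · have h := hi.2 x hx.1 y (Finset.mem_insert_of_mem hy) hxy
    exact (Finset.mem_insert.1 h).resolve_left fun h => hx.2 (h.trans hinf.symm)

/-- A locally constant coloring stays locally constant if a fixed finite set is put in front. -/
theorem LocConst.union_left {κ : Type*} {A A' : Set ℕ} {c : Set ℕ → κ} (hc : LocConst A c)
    {s : Finset ℕ} (hs : ↑s ⊆ A) (hA' : A' ⊆ A) (hlt : ∀ x ∈ s, ∀ a ∈ A', x < a) :
    LocConst A' fun X => c (↑s ∪ X) := by
  intro X hXA hX
  obtain ⟨u, hu, hcu⟩ := hc (↑s ∪ X) (Set.union_subset hs (hXA.trans hA'))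
    (hX.mono Set.subset_union_right)
  refine ⟨u \ s, ⟨fun x hx => ?_, fun x hx y hy hxy => ?_⟩, fun Z hZA hZ hi =>
    hcu _ (Set.union_subset hs (hZA.trans hA')) (hZ.mono Set.subset_union_right) ⟨?_, ?_⟩⟩
  · rw [Finset.mem_sdiff] at hx
    exact (hu.1 x hx.1).resolve_left hx.2
  · rw [Finset.mem_sdiff] at hy ⊢
    exact ⟨hu.2 x (Or.inr hx) y hy.1 hxy, fun h => (hlt x h x (hXA hx)).false⟩
  · intro x hx
    by_cases hxs : x ∈ s
    · exact Or.inl hxs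
    · exact Or.inr (hi.1 x (Finset.mem_sdiff.2 ⟨hx, hxs⟩))
  · rintro x (hx | hx) y hy hxy
    · exact hu.2 x (Or.inl hx) y hy hxy
    · have hys : y ∉ s := fun h => absurd hxy (not_le.2 (hlt y h x (hZA hx)))
      exact (Finset.mem_sdiff.1 (hi.2 x hx y (Finset.mem_sdiff.2 ⟨hy, hys⟩) hxy)).1

/-- A locally constant two-coloring is constant on the infinite subsets of some infinite set. -/
theorem LocConst.exists_homogeneous_prop {A : Set ℕ} {c : Set ℕ → Prop} (hc : LocConst A c)
    (hA : A.Infinite) : ∃ Y ⊆ A, Y.Infinite ∧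
      ((∀ Z ⊆ Y, Z.Infinite → c Z) ∨ ∀ Z ⊆ Y, Z.Infinite → ¬ c Z) := by
  obtain ⟨Y, hYA, hY, h⟩ := exists_forall_initial_or_forall_notMem
    {u | ∀ Z ⊆ A, Z.Infinite → IsInitialSegment u Z → c Z} hA
  refine ⟨Y, hYA, hY, h.imp (fun h Z hZY hZ => ?_) fun h Z hZY hZ hcZ => ?_⟩
  · obtain ⟨u, hu, hi⟩ := h Z hZY hZ
    exact hu Z (hZY.trans hYA) hZ hi
  · obtain ⟨u, hu, hcu⟩ := hc Z (hZY.trans hYA) hZ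
    exact h u (fun x hx => hZY (hu.1 x hx)) fun W hWA hW hi => (hcu W hWA hW hi).mpr hcZ

/-- A locally constant coloring with finitely many colors is constant on the infinite subsets of
some infinite set. -/
theorem LocConst.exists_homogeneous {κ : Type*} (K : Set κ) (hK : K.Finite) {A : Set ℕ}
    {c : Set ℕ → κ} (hc : LocConst A c) (hA : A.Infinite)
    (hcK : ∀ Z ⊆ A, Z.Infinite → c Z ∈ K) :
    ∃ k ∈ K, ∃ Y ⊆ A, Y.Infinite ∧ ∀ Z ⊆ Y, Z.Infinite → c Z = k := by
  induction K, hK using Set.Finite.induction_on generalizing A with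
  | empty => exact (hcK A subset_rfl hA).elim
  | @insert k K _ _ ih =>
    obtain ⟨Y, hYA, hY, h | h⟩ := (hc.comp (· = k)).exists_homogeneous_prop hA
    · exact ⟨k, Set.mem_insert _ _, Y, hYA, hY, h⟩
    · obtain ⟨k', hk', Y', hY', h'⟩ := ih (hc.mono hYA) hY fun Z hZY hZ =>
        (hcK Z (hZY.trans hYA) hZ).resolve_left (h Z hZY hZ)
      exact ⟨k', Set.mem_insert_of_mem _ hk', Y', hY'.trans hYA, h'⟩

/-! ### Fronts: the member of a barrier at the beginning of an infinite set -/

namespace IsBarrier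

variable {B : Set (Finset ℕ)}

theorem eq_of_subset (hB : IsBarrier B) {s t : Finset ℕ} (hs : s ∈ B) (ht : t ∈ B) (h : s ⊆ t) :
    s = t := by
  by_contra hne
  exact hB.antichain s hs t ht hne h

theorem nonempty_of_mem (hB : IsBarrier B) {s : Finset ℕ} (hs : s ∈ B) : s.Nonempty := by
  rw [Finset.nonempty_iff_ne_empty]
  rintro rfl
  refine hB.infinite ((Set.finite_singleton ∅).subset fun t ht => ?_)
  exact (hB.eq_of_subset hs ht (Finset.empty_subset t)).symm

theorem eq_of_isInitialSegment (hB : IsBarrier B) {s t : Finset ℕ} {X : Set ℕ} (hs : s ∈ B)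
    (ht : t ∈ B) (hsX : IsInitialSegment s X) (htX : IsInitialSegment t X) : s = t := by
  rcases hsX.subset_or_subset htX with h | h
  · exact hB.eq_of_subset hs ht h
  · exact (hB.eq_of_subset ht hs h).symm

theorem infinite_base (hB : IsBarrier B) : (barrierBase B).Infinite := by
  intro h
  refine hB.infinite ((Set.Finite.finite_subsets h).preimage
    Finset.coe_injective.injOn |>.subset fun s hs => ?_)
  exact fun x hx => ⟨s, hs, hx⟩

end IsBarrier

open Classical in
/-- The member of `B` which is an initial segment of `X`; the empty set if there is none. -/
noncomputable def barrierFront (B : Set (Finset ℕ)) (X : Set ℕ) : Finset ℕ :=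
  if h : ∃ s ∈ B, IsInitialSegment s X then h.choose else ∅

namespace IsBarrier

variable {B : Set (Finset ℕ)}

theorem barrierFront_spec (hB : IsBarrier B) {X : Set ℕ} (hXB : X ⊆ barrierBase B)
    (hX : X.Infinite) : barrierFront B X ∈ B ∧ IsInitialSegment (barrierFront B X) X := by
  have h := hB.exists_initial X hXB hX
  rw [barrierFront, dif_pos h]
  exact h.choose_spec

theorem barrierFront_subset (hB : IsBarrier B) {X : Set ℕ} (hXB : X ⊆ barrierBase B)
    (hX : X.Infinite) : ↑(barrierFront B X) ⊆ X :=
  (hB.barrierFront_spec hXB hX).2.1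

theorem barrierFront_eq (hB : IsBarrier B) {s : Finset ℕ} {X : Set ℕ} (hs : s ∈ B)
    (hsX : IsInitialSegment s X) : barrierFront B X = s := by
  have h : ∃ s ∈ B, IsInitialSegment s X := ⟨s, hs, hsX⟩
  rw [barrierFront, dif_pos h]
  exact hB.eq_of_isInitialSegment h.choose_spec.1 hs h.choose_spec.2 hsX

theorem locConst_barrierFront (hB : IsBarrier B) :
    LocConst (barrierBase B) (barrierFront B) := fun _ hXB hX =>
  ⟨_, (hB.barrierFront_spec hXB hX).2, fun _ _ _ hi =>
    hB.barrierFront_eq (hB.barrierFront_spec hXB hX).1 hi⟩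

theorem locConst_pair (hB : IsBarrier B) : LocConst (barrierBase B) fun X =>
    (barrierFront B X, barrierFront B (setTail X)) :=
  hB.locConst_barrierFront.prodMk hB.locConst_barrierFront.setTail

theorem shiftExtends_barrierFront (hB : IsBarrier B) {X : Set ℕ} (hXB : X ⊆ barrierBase B)
    (hX : X.Infinite) : ShiftExtends (barrierFront B X) (barrierFront B (setTail X)) := by
  obtain ⟨hs, hsX⟩ := hB.barrierFront_spec hXB hX
  obtain ⟨ht, htX⟩ := hB.barrierFront_spec ((setTail_subset X).trans hXB) hX.setTail
  generalize barrierFront B X = s at *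
  generalize barrierFront B (setTail X) = t at *
  have hsne := hB.nonempty_of_mem hs
  have htne := hB.nonempty_of_mem ht
  have hmin : s.min' hsne = sInf X := by
    have h1 := Nat.sInf_mem hX.nonempty
    have h2 := hsX.2 _ h1 _ (s.min'_mem hsne) (Nat.sInf_le (hsX.1 _ (s.min'_mem hsne)))
    exact le_antisymm (s.min'_le _ h2) (Nat.sInf_le (hsX.1 _ (s.min'_mem hsne)))
  have hnot : ¬ t ⊆ s.erase (s.min' hsne) := by
    intro h
    have heq := hB.eq_of_subset ht hs (h.trans (Finset.erase_subset _ _))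
    rw [heq] at h
    exact Finset.notMem_erase _ _ (h (s.min'_mem hsne))
  have hinit : IsInitialSegment (s.erase (s.min' hsne)) (setTail X) := by
    refine ⟨fun x hx => ?_, fun x hx y hy hxy => ?_⟩
    · obtain ⟨h1, h2⟩ := Finset.mem_erase.1 hx
      exact ⟨hsX.1 x h2, fun h => h1 (h.trans hmin.symm)⟩
    · exact Finset.mem_erase.2 ⟨fun h => hx.2 (h.trans hmin),
        hsX.2 x hx.1 y (Finset.mem_of_mem_erase hy) hxy⟩
  refine ⟨hsne, htne, ?_, ⟨?_, ?_⟩, ?_⟩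
  · rw [hmin]
    exact sInf_lt_of_mem_setTail (htX.1 _ (t.min'_mem htne))
  · exact (hinit.subset_or_subset htX).resolve_right hnot
  · exact fun x hx => hinit.2 x (htX.1 x hx)
  · exact fun h => hnot h.ge

/-- Every pair `s`, `t` of members of a barrier such that `t` shift-extends `s` consists of the
fronts of `Z` and of its tail, for every infinite `Z` which starts with the elements of `s ∪ t`. -/
theorem barrierFront_of_shiftExtends (hB : IsBarrier B) {s t : Finset ℕ} (hs : s ∈ B) (ht : t ∈ B)
    (hst : ShiftExtends s t) {Z : Set ℕ} (hi : IsInitialSegment (s ∪ t) Z) :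
    barrierFront B Z = s ∧ barrierFront B (setTail Z) = t := by
  obtain ⟨hsne, htne, hlt, hinit, -⟩ := hst
  have hmem : s.min' hsne ∈ Z := hi.1 _ (Finset.mem_union_left _ (s.min'_mem hsne))
  have hltt : ∀ y ∈ t, s.min' hsne < y := fun y hy => hlt.trans_le (t.min'_le y hy)
  have hinf : sInf Z = s.min' hsne := by
    refine le_antisymm (Nat.sInf_le hmem) ?_
    have h := hi.2 _ (Nat.sInf_mem ⟨_, hmem⟩) _ (Finset.mem_union_left _ (s.min'_mem hsne))
      (Nat.sInf_le hmem)
    rcases Finset.mem_union.1 h with h | h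
    · exact s.min'_le _ h
    · exact (hltt _ h).le
  constructor
  · refine hB.barrierFront_eq hs ⟨fun x hx => hi.1 x (Finset.mem_union_left _ hx), ?_⟩
    intro x hx y hy hxy
    rcases Finset.mem_union.1 (hi.2 x hx y (Finset.mem_union_left _ hy) hxy) with h | h
    · exact h
    · have hy' : y ∈ s.erase (s.min' hsne) :=
        Finset.mem_erase.2 ⟨((hltt x h).trans_le hxy).ne', hy⟩
      exact Finset.mem_of_mem_erase (hinit.2 x h y hy' hxy)
  · refine hB.barrierFront_eq ht ⟨fun x hx => ⟨hi.1 x (Finset.mem_union_right _ hx), ?_⟩, ?_⟩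
    · rw [hinf]
      exact (hltt x hx).ne'
    · intro x hx y hy hxy
      rcases Finset.mem_union.1 (hi.2 x hx.1 y (Finset.mem_union_right _ hy) hxy) with h | h
      · exact hinit.1 x (Finset.mem_erase.2 ⟨fun h' => hx.2 (h'.trans hinf.symm), h⟩)
      · exact h

end IsBarrier

theorem isInitialSegment_union_above (u : Finset ℕ) (X : Set ℕ) :
    IsInitialSegment u (↑u ∪ {y ∈ X | ∀ x ∈ u, x < y}) := by
  refine ⟨fun x hx => Or.inl hx, ?_⟩
  rintro x (hx | hx) y hy hxy
  · exact hx
  · exact absurd hxy (not_le.2 (hx.2 y hy))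

/-! ### Arrays along a fixed barrier -/

/-- The part of the barrier `B` which lies inside the infinite set `X`. -/
def barrierRestrict (B : Set (Finset ℕ)) (X : Set ℕ) : Set (Finset ℕ) := {s ∈ B | ↑s ⊆ X}

theorem IsBarrier.restrict {B : Set (Finset ℕ)} (hB : IsBarrier B) {X : Set ℕ}
    (hXB : X ⊆ barrierBase B) (hX : X.Infinite) : IsBarrier (barrierRestrict B X) where
  infinite := by
    intro hfin
    -- The front of the part of `X` above all members of a finite restriction is a new member.
    obtain ⟨h1, h2⟩ := hB.barrierFront_spec (X := {y ∈ X | ∀ x ∈ hfin.toFinset.sup id, x < y})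
      (fun y hy => hXB hy.1) (hX.inter_above _)
    obtain ⟨a, ha⟩ := hB.nonempty_of_mem h1
    have hmem : barrierFront B {y ∈ X | ∀ x ∈ hfin.toFinset.sup id, x < y} ∈ hfin.toFinset :=
      hfin.mem_toFinset.2 ⟨h1, fun x hx => (h2.1 x hx).1⟩
    exact ((h2.1 a ha).2 a (Finset.le_sup (f := id) hmem ha)).false
  antichain s hs t ht := hB.antichain s hs.1 t ht.1
  exists_initial Y hY hYinf := by
    have hYX : Y ⊆ X := fun y hy =>
      let ⟨_, hs, hys⟩ := hY hy
      hs.2 hys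
    obtain ⟨s, hs, hsY⟩ := hB.exists_initial Y (hYX.trans hXB) hYinf
    exact ⟨s, ⟨hs, fun x hx => hYX (hsY.1 x hx)⟩, hsY⟩

theorem IsBarrier.type_restrict_le {B : Set (Finset ℕ)} (hB : IsBarrier B) {X : Set ℕ}
    (hXB : X ⊆ barrierBase B) (hX : X.Infinite) : (hB.restrict hXB hX).type ≤ hB.type := by
  have := hB.isWellOrder
  have := (hB.restrict hXB hX).isWellOrder
  exact Ordinal.type_le_iff'.2
    ⟨⟨⟨fun s => ⟨s.1, s.2.1⟩, fun s t h => Subtype.ext (congrArg (fun u : B => u.1) h)⟩,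
      Iff.rfl⟩⟩

theorem IsBarrier.type_lt_omega_one {B : Set (Finset ℕ)} (hB : IsBarrier B) : hB.type < ω₁ := by
  have := hB.isWellOrder
  have h : (Ordinal.type (barrierLex B)).card ≤ Cardinal.aleph0 := by
    rw [Ordinal.card_type]
    exact Cardinal.mk_le_aleph0
  rw [← Cardinal.ord_aleph, Cardinal.lt_ord, ← Cardinal.succ_aleph0, Order.lt_succ_iff]
  exact h

/-- `S` has no bad arrays along `B`: every array with values in `S` on the part of `B` inside some
infinite set is good. The array is extended to all finite sets of natural numbers, by arbitrary
values. -/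
def IsWqoAlong (B : Set (Finset ℕ)) {Q : Type*} [LE Q] (S : Set Q) : Prop :=
  ∀ X ⊆ barrierBase B, X.Infinite → ∀ f : Finset ℕ → Q, (∀ s ∈ B, ↑s ⊆ X → f s ∈ S) →
    ∃ s ∈ B, ∃ t ∈ B, ↑s ⊆ X ∧ ↑t ⊆ X ∧ ShiftExtends s t ∧ f s ≤ f t

/-- Transfer of `α`-wqo from `P` to its image under a monotone map `e`: the identity, or the
inclusion of a subset with the induced order. -/
theorem IsAlphaWqo.isWqoAlong {α : Ordinal.{0}} {P : Type*} [PartialOrder P]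
    (h : IsAlphaWqo α P) {B : Set (Finset ℕ)} (hB : IsBarrier B) (hα : hB.type ≤ α) {Q : Type*}
    [LE Q] (e : P → Q) (he : ∀ a b, a ≤ b → e a ≤ e b) {S : Set Q} (hS : S ⊆ Set.range e) :
    IsWqoAlong B S := by
  intro X hXB hX f hf
  have hf' : ∀ s : barrierRestrict B X, ∃ p, e p = f s.1 := fun s => hS (hf s.1 s.2.1 s.2.2)
  choose g hg using hf'
  obtain ⟨s, t, hst, hle⟩ := h _ (hB.restrict hXB hX) ((hB.type_restrict_le hXB hX).trans hα) g
  refine ⟨s.1, s.2.1, t.1, t.2.1, s.2.2, t.2.2, hst, ?_⟩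
  rw [← hg, ← hg]
  exact he _ _ hle

/-- Conversely to `IsAlphaWqo.isWqoAlong`, arrays are transferred along an order-reflecting map. -/
theorem IsWqoAlong.isGoodArray {B : Set (Finset ℕ)} (hB : IsBarrier B) {Q : Type*} [LE Q]
    {S : Set Q} (h : IsWqoAlong B S) {P : Type*} [PartialOrder P] (e : P → Q)
    (he : ∀ a b, e a ≤ e b → a ≤ b) (hS : ∀ a, e a ∈ S) (f : B → P) : IsGoodArray B f := by
  classical
  obtain ⟨s₀, hs₀⟩ := hB.infinite.nonempty
  obtain ⟨s, hs, t, ht, -, -, hst, hle⟩ := h _ subset_rfl hB.infinite_base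
    (fun s => e (if hs : s ∈ B then f ⟨s, hs⟩ else f ⟨s₀, hs₀⟩)) fun _ _ _ => hS _
  refine ⟨⟨s, hs⟩, ⟨t, ht⟩, hst, ?_⟩
  simp only [dif_pos hs, dif_pos ht] at hle
  exact he _ _ hle

/-- No bound on types remains, as every barrier has countable type. -/
theorem isBqo_iff_isWqoAlong {P : Type*} [PartialOrder P] (S : Set P) :
    IsBqo S ↔ ∀ B, IsBarrier B → IsWqoAlong B S := by
  refine ⟨fun h B hB => (h _ hB.type_lt_omega_one).isWqoAlong hB le_rfl Subtype.val
    (fun _ _ h => h) Subtype.range_val.ge, fun h α _ B hB _ f => ?_⟩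
  exact (h B hB).isGoodArray hB Subtype.val (fun _ _ h => h) Subtype.prop f

theorem IsWqoAlong.mono {B : Set (Finset ℕ)} {Q : Type*} [LE Q] {S T : Set Q}
    (h : IsWqoAlong B T) (hST : S ⊆ T) : IsWqoAlong B S :=
  fun X hXB hX f hf => h X hXB hX f fun s hs hsX => hST (hf s hs hsX)

theorem IsBarrier.exists_barrierFront_eq {B : Set (Finset ℕ)} (hB : IsBarrier B) {X : Set ℕ}
    (hX : X.Infinite) {s : Finset ℕ} (hs : s ∈ B) (hsX : ↑s ⊆ X) :
    ∃ Z ⊆ X, Z.Infinite ∧ barrierFront B Z = s :=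
  ⟨↑s ∪ {y ∈ X | ∀ x ∈ s, x < y}, Set.union_subset hsX fun _ hy => hy.1,
    (hX.inter_above s).mono Set.subset_union_right,
    hB.barrierFront_eq hs (isInitialSegment_union_above s X)⟩

theorem IsBarrier.exists_pair_eq {B : Set (Finset ℕ)} (hB : IsBarrier B) {X : Set ℕ}
    (hX : X.Infinite) {s t : Finset ℕ} (hs : s ∈ B) (hsX : ↑s ⊆ X) (ht : t ∈ B) (htX : ↑t ⊆ X)
    (hst : ShiftExtends s t) :
    ∃ Z ⊆ X, Z.Infinite ∧ barrierFront B Z = s ∧ barrierFront B (setTail Z) = t := by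
  refine ⟨↑(s ∪ t) ∪ {y ∈ X | ∀ x ∈ s ∪ t, x < y}, Set.union_subset ?_ fun _ hy => hy.1,
    (hX.inter_above (s ∪ t)).mono Set.subset_union_right,
    hB.barrierFront_of_shiftExtends hs ht hst (isInitialSegment_union_above _ X)⟩
  rw [Finset.coe_union]
  exact Set.union_subset hsX htX

theorem IsWqoAlong.union {B : Set (Finset ℕ)} (hB : IsBarrier B) {Q : Type*} [LE Q]
    {S T : Set Q} (hS : IsWqoAlong B S) (hT : IsWqoAlong B T) : IsWqoAlong B (S ∪ T) := by
  intro X hXB hX f hf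
  have hc : LocConst X fun Z => f (barrierFront B Z) ∈ S :=
    (hB.locConst_barrierFront.mono hXB).comp fun s => f s ∈ S
  obtain ⟨Y, hYX, hY, h⟩ := hc.exists_homogeneous_prop hX
  have hgood : ∃ s ∈ B, ∃ t ∈ B, ↑s ⊆ Y ∧ ↑t ⊆ Y ∧ ShiftExtends s t ∧ f s ≤ f t := by
    rcases h with h | h
    · refine hS Y (hYX.trans hXB) hY f fun s hs hsY => ?_
      obtain ⟨Z, hZY, hZ, rfl⟩ := hB.exists_barrierFront_eq hY hs hsY
      exact h Z hZY hZ
    · refine hT Y (hYX.trans hXB) hY f fun s hs hsY => ?_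
      refine (hf s hs (hsY.trans hYX)).resolve_left ?_
      obtain ⟨Z, hZY, hZ, rfl⟩ := hB.exists_barrierFront_eq hY hs hsY
      exact h Z hZY hZ
  obtain ⟨s, hs, t, ht, hsY, htY, hst, hle⟩ := hgood
  exact ⟨s, hs, t, ht, hsY.trans hYX, htY.trans hYX, hst, hle⟩

theorem IsWqoAlong.biUnion_le {B : Set (Finset ℕ)} (hB : IsBarrier B) {Q : Type*} [LE Q]
    {S : ℕ → Set Q} (hS : ∀ n, IsWqoAlong B (S n)) (n : ℕ) :
    IsWqoAlong B (⋃ m ≤ n, S m) := by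
  induction n with
  | zero => simpa using hS 0
  | succ n ih =>
    refine (ih.union hB (hS (n + 1))).mono fun x hx => ?_
    simp only [Set.mem_iUnion, exists_prop] at hx
    obtain ⟨m, hm, hx⟩ := hx
    rcases Nat.le_succ_iff.1 hm with hm | rfl
    · exact Or.inl (by simpa using ⟨m, hm, hx⟩)
    · exact Or.inr hx

/-! ### Uniformization and homogeneous pairs -/

/-- Uniformization: if for all `s`, `t` in `B` such that `t` shift-extends `s` some element of a
finite set depending only on `s` is related to `s` and `t`, then on some restriction of `B` that
element can be chosen independently of `t`. -/
theorem IsBarrier.exists_uniform {B : Set (Finset ℕ)} (hB : IsBarrier B) {κ : Type*} {X : Set ℕ}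
    (hXB : X ⊆ barrierBase B) (hX : X.Infinite) (K : Finset ℕ → Set κ)
    (R : Finset ℕ → Finset ℕ → κ → Prop) (hK : ∀ s ∈ B, (K s).Finite)
    (hR : ∀ s ∈ B, ∀ t ∈ B, ↑s ⊆ X → ↑t ⊆ X → ShiftExtends s t → ∃ k ∈ K s, R s t k) :
    ∃ Y ⊆ X, Y.Infinite ∧ ∀ s ∈ B, ↑s ⊆ Y →
      ∃ k ∈ K s, ∀ t ∈ B, ↑t ⊆ Y → ShiftExtends s t → R s t k := by
  classical
  let D : Finset ℕ → Set ℕ → Prop := fun s Y => s ∈ B → ↑s ⊆ X → ∃ k ∈ K s, ∀ t ∈ B,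
    (↑(t \ s) : Set ℕ) ⊆ Y → ShiftExtends s t → R s t k
  have mono : ∀ s Y Z, Z ⊆ Y → D s Y → D s Z := by
    intro s Y Z hZY h hs hsX
    obtain ⟨k, hk, hkR⟩ := h hs hsX
    exact ⟨k, hk, fun t ht htZ => hkR t ht (htZ.trans hZY)⟩
  have dense : ∀ s, ∀ Y ⊆ X, Y.Infinite → ∃ Z ⊆ Y, Z.Infinite ∧ D s Z := by
    intro s Y hYX hY
    by_cases hs : s ∈ B ∧ ↑s ⊆ X
    · -- The sets `s ∪ Z` with `Z` above `s` have front `s`, so that the front of their tails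
      -- shift-extends `s`. Color `Z` by an element related to `s` and this front.
      let A : Set ℕ := {y ∈ Y | ∀ x ∈ s, x < y}
      have hAX : A ⊆ X := fun y hy => hYX hy.1
      have hAinf : A.Infinite := hY.inter_above s
      have hfront : ∀ Z ⊆ A, Z.Infinite → ∃ k ∈ K s,
          R s (barrierFront B (setTail (↑s ∪ Z))) k := by
        intro Z hZA hZ
        have hsZX : ↑s ∪ Z ⊆ X := Set.union_subset hs.2 (hZA.trans hAX)
        have hsZ : (↑s ∪ Z).Infinite := hZ.mono Set.subset_union_right
        have hinit : IsInitialSegment s (↑s ∪ Z) := by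
          refine ⟨fun x hx => Or.inl hx, ?_⟩
          rintro x (hx | hx) y hy hxy
          · exact hx
          · exact absurd hxy (not_le.2 ((hZA hx).2 y hy))
        have hst := hB.shiftExtends_barrierFront (hsZX.trans hXB) hsZ
        rw [hB.barrierFront_eq hs.1 hinit] at hst
        have htX := (setTail_subset (↑s ∪ Z)).trans hsZX
        exact hR s hs.1 _ (hB.barrierFront_spec (htX.trans hXB) hsZ.setTail).1 hs.2
          ((hB.barrierFront_subset (htX.trans hXB) hsZ.setTail).trans htX) hst
      obtain ⟨k₀, -⟩ := hfront A subset_rfl hAinf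
      let pick : Finset ℕ → κ := fun t => if h : ∃ k ∈ K s, R s t k then h.choose else k₀
      have hpick : ∀ t, (∃ k ∈ K s, R s t k) → pick t ∈ K s ∧ R s t (pick t) := by
        intro t h
        simp only [pick, dif_pos h]
        exact h.choose_spec
      have hc : LocConst A fun Z => pick (barrierFront B (setTail (↑s ∪ Z))) :=
        (hB.locConst_barrierFront.setTail.comp pick).union_left (hs.2.trans hXB)
          (hAX.trans hXB) fun x hx a ha => ha.2 x hx
      obtain ⟨k, hk, Y', hY'A, hY', hconst⟩ := hc.exists_homogeneous (K s) (hK s hs.1) hAinf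
        fun Z hZA hZ => (hpick _ (hfront Z hZA hZ)).1
      refine ⟨Y', fun y hy => (hY'A hy).1, hY', fun _ _ => ⟨k, hk, fun t ht htY hst => ?_⟩⟩
      -- Every `t` that shift-extends `s` is the front of such a tail.
      let Z : Set ℕ := ↑(t \ s) ∪ {y ∈ Y' | ∀ x ∈ s ∪ t, x < y}
      have hZY : Z ⊆ Y' := Set.union_subset htY fun y hy => hy.1
      have hZ : Z.Infinite := (hY'.inter_above _).mono Set.subset_union_right
      have heq : (↑s ∪ Z : Set ℕ) = ↑(s ∪ t) ∪ {y ∈ Y' | ∀ x ∈ s ∪ t, x < y} := by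
        rw [← Set.union_assoc, Finset.coe_sdiff, Finset.coe_union, Set.union_sdiff_self]
      have ht' : barrierFront B (setTail (↑s ∪ Z)) = t := by
        rw [heq]
        exact (hB.barrierFront_of_shiftExtends hs.1 ht hst (isInitialSegment_union_above _ _)).2
      have h1 := hconst Z hZY hZ
      have h2 := (hpick _ (hfront Z (hZY.trans hY'A) hZ)).2
      rw [h1, ht'] at h2
      exact h2
    · exact ⟨Y, subset_rfl, hY, fun h1 h2 => absurd ⟨h1, h2⟩ hs⟩
  obtain ⟨Y, hYX, hY, hD⟩ := exists_diagonal hX mono dense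
  refine ⟨Y, hYX, hY, fun s hs hsY => ?_⟩
  obtain ⟨k, hk, hkR⟩ := hD s hsY hs (hsY.trans hYX)
  refine ⟨k, hk, fun t ht htY hst => hkR t ht (fun x hx => ?_) hst⟩
  -- The elements of `t` outside `s` lie above `s`.
  rw [Finset.coe_sdiff] at hx
  refine ⟨htY hx.1, fun y hy => lt_of_not_ge fun hxy => hx.2 ?_⟩
  obtain ⟨hsne, htne, hlt, hinit, -⟩ := hst
  have hmx := hlt.trans_le (t.min'_le x hx.1)
  exact Finset.mem_of_mem_erase (hinit.2 x hx.1 y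
    (Finset.mem_erase.2 ⟨(hmx.trans_le hxy).ne', hy⟩) hxy)

/-- A relation between members of a barrier holds for all pairs, or for no pair, of a member and
one of its shift extensions, on some restriction of the barrier. -/
theorem IsBarrier.exists_homogeneous_pairs {B : Set (Finset ℕ)} (hB : IsBarrier B) {X : Set ℕ}
    (hXB : X ⊆ barrierBase B) (hX : X.Infinite) (R : Finset ℕ → Finset ℕ → Prop) :
    ∃ Y ⊆ X, Y.Infinite ∧
      ((∀ s ∈ B, ∀ t ∈ B, ↑s ⊆ Y → ↑t ⊆ Y → ShiftExtends s t → R s t) ∨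
        ∀ s ∈ B, ∀ t ∈ B, ↑s ⊆ Y → ↑t ⊆ Y → ShiftExtends s t → ¬ R s t) := by
  have hc : LocConst X fun Z => R (barrierFront B Z) (barrierFront B (setTail Z)) :=
    (hB.locConst_pair.mono hXB).comp fun p => R p.1 p.2
  obtain ⟨Y, hYX, hY, h⟩ := hc.exists_homogeneous_prop hX
  refine ⟨Y, hYX, hY, h.imp ?_ ?_⟩
  all_goals
    intro h s hs t ht hsY htY hst
    obtain ⟨Z, hZY, hZ, rfl, rfl⟩ := hB.exists_pair_eq hY hs hsY ht htY hst
    exact h Z hZY hZ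

/-- Any two members of a barrier are connected by a path of shift extensions, through the fronts of
sets far out. -/
theorem IsBarrier.eq_of_forall_shiftExtends {B : Set (Finset ℕ)} (hB : IsBarrier B) {X : Set ℕ}
    (hXB : X ⊆ barrierBase B) (hX : X.Infinite) {κ : Type*} (g : Finset ℕ → κ)
    (h : ∀ s ∈ B, ∀ t ∈ B, ↑s ⊆ X → ↑t ⊆ X → ShiftExtends s t → g s = g t)
    {s : Finset ℕ} (hs : s ∈ B) (hsX : ↑s ⊆ X) : g s = g (barrierFront B X) := by
  have htail : ∀ Z ⊆ X, Z.Infinite → g (barrierFront B Z) = g (barrierFront B (setTail Z)) := by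
    intro Z hZX hZ
    have hZ' := (setTail_subset Z).trans hZX
    exact h _ (hB.barrierFront_spec (hZX.trans hXB) hZ).1 _
      (hB.barrierFront_spec (hZ'.trans hXB) hZ.setTail).1
      ((hB.barrierFront_subset (hZX.trans hXB) hZ).trans hZX)
      ((hB.barrierFront_subset (hZ'.trans hXB) hZ.setTail).trans hZ')
      (hB.shiftExtends_barrierFront (hZX.trans hXB) hZ)
  have hfar : ∀ Z ⊆ X, Z.Infinite → ∀ n,
      g (barrierFront B Z) = g (barrierFront B {z ∈ Z | n ≤ z}) := by
    intro Z hZX hZ n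
    induction n with
    | zero => simp
    | succ n ih =>
      rw [ih]
      have hinf : {z ∈ Z | n ≤ z}.Infinite :=
        (hZ.inter_above (Finset.range n)).mono fun z hz => ⟨hz.1, by
          by_contra hlt
          exact (hz.2 z (Finset.mem_range.2 (not_le.1 hlt))).false⟩
      by_cases hn : n ∈ Z
      · have hmin : sInf {z ∈ Z | n ≤ z} = n :=
          le_antisymm (Nat.sInf_le ⟨hn, le_rfl⟩) (Nat.sInf_mem hinf.nonempty).2
        have heq : {z ∈ Z | n + 1 ≤ z} = setTail {z ∈ Z | n ≤ z} := by
          ext z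
          simp only [setTail, hmin, Set.mem_sdiff, Set.mem_ofPred_eq, Set.mem_singleton_iff]
          constructor
          · exact fun hz => ⟨⟨hz.1, by omega⟩, by omega⟩
          · exact fun hz => ⟨hz.1.1, by omega⟩
        rw [heq]
        exact htail _ (fun z hz => hZX hz.1) hinf
      · congr 2
        ext z
        simp only [Set.mem_ofPred_eq]
        refine and_congr_right fun hz => ⟨fun h => ?_, fun h => by omega⟩
        exact lt_of_le_of_ne h fun h' => hn (h' ▸ hz)
  -- `X` and the set `Z` starting with `s` agree above `s`.
  let Z : Set ℕ := ↑s ∪ {y ∈ X | ∀ x ∈ s, x < y}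
  have hZX : Z ⊆ X := Set.union_subset hsX fun y hy => hy.1
  have hZ : Z.Infinite := (hX.inter_above s).mono Set.subset_union_right
  have heq : {z ∈ Z | s.sup id + 1 ≤ z} = {z ∈ X | s.sup id + 1 ≤ z} := by
    ext z
    refine ⟨fun hz => ⟨hZX hz.1, hz.2⟩, fun hz => ⟨Or.inr ⟨hz.1, fun x hx => ?_⟩, hz.2⟩⟩
    exact lt_of_le_of_lt (Finset.le_sup (f := id) hx) hz.2
  rw [← hB.barrierFront_eq hs (isInitialSegment_union_above s X)]
  exact (hfar Z hZX hZ _).trans ((congrArg (fun W => g (barrierFront B W)) heq).trans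
    (hfar X subset_rfl hX _).symm)

/-! ### The Dress–Schiffels product along a barrier -/

namespace DressSchiffels

section

variable {I : Type*} {P : I → Type*} [∀ i, PartialOrder (P i)] [∀ i, OrderBot (P i)]

/-- The set of elements of the product with support in `J` whose nonzero values lie in the
sets `Q i`. -/
def restrict (J : Set I) (Q : ∀ i, Set (P i)) : Set (DressSchiffels P) :=
  {f | ∀ i, f.1 i ≠ ⊥ → i ∈ J ∧ f.1 i ∈ Q i}

theorem restrict_univ : restrict (P := P) Set.univ (fun _ => Set.univ) = Set.univ :=
  Set.eq_univ_of_forall fun _ _ _ => ⟨trivial, trivial⟩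

end

variable {I : Type*} [PartialOrder I] {P : I → Type*} [∀ i, PartialOrder (P i)]
  [∀ i, OrderBot (P i)]

/-- If `f ≤ g` fails, this is witnessed by an index in the support of `f`, since a zero value of `f`
lies below the value of `g`. -/
theorem exists_of_not_le {f g : DressSchiffels P} (h : ¬ f ≤ g) :
    ∃ i ∈ {i | f.1 i ≠ ⊥}, (∀ j, i < j → f.1 j = g.1 j) ∧ ¬ f.1 i ≤ g.1 i := by
  rw [le_def] at h
  push Not at h
  obtain ⟨i, hi, hlt⟩ := h
  have hle : ¬ f.1 i ≤ g.1 i := fun h => hlt (lt_of_le_of_ne h hi.1)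
  refine ⟨i, fun h => hle (h ▸ bot_le), fun j hij => ?_, hle⟩
  by_contra hj
  exact (hi.2 hj hij.le).not_gt hij

/-- The crux: along a fixed barrier `B`, the product has no bad arrays if the index set and the
factors have none. -/
theorem isWqoAlong_restrict {B : Set (Finset ℕ)} (hB : IsBarrier B) {J : Set I}
    {Q : ∀ i, Set (P i)} (hJ : IsWqoAlong B J) (hQ : ∀ i, IsWqoAlong B (Q i)) :
    IsWqoAlong B (restrict J Q) := by
  intro X₀ hX₀B hX₀ F hF
  by_contra! hbad
  -- The index witnessing `¬ F s ≤ F t` lies in the finite support of `F s`: make it depend on `s`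
  -- only.
  obtain ⟨X₁, hX₁X₀, hX₁, huni⟩ := hB.exists_uniform hX₀B hX₀ (fun s => {i | (F s).1 i ≠ ⊥})
    (fun s t i => (∀ j, i < j → (F s).1 j = (F t).1 j) ∧ ¬ (F s).1 i ≤ (F t).1 i)
    (fun s _ => (F s).2)
    fun s hs t ht hsX htX hst => exists_of_not_le (hbad s hs t ht hsX htX hst)
  have hX₁B := hX₁X₀.trans hX₀B
  have hfront₁ := hB.barrierFront_spec hX₁B hX₁
  obtain ⟨i₀, -⟩ := huni _ hfront₁.1 hfront₁.2.1
  have huni' : ∀ s, ∃ i, s ∈ B → ↑s ⊆ X₁ → (F s).1 i ≠ ⊥ ∧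
      ∀ t ∈ B, ↑t ⊆ X₁ → ShiftExtends s t →
        (∀ j, i < j → (F s).1 j = (F t).1 j) ∧ ¬ (F s).1 i ≤ (F t).1 i := by
    intro s
    by_cases h : s ∈ B ∧ ↑s ⊆ X₁
    · obtain ⟨i, hi⟩ := huni s h.1 h.2
      exact ⟨i, fun _ _ => hi⟩
    · exact ⟨i₀, fun h1 h2 => absurd ⟨h1, h2⟩ h⟩
  choose i hi using huni'
  have hFi : ∀ s ∈ B, ↑s ⊆ X₁ → i s ∈ J ∧ (F s).1 (i s) ∈ Q (i s) := fun s hs hsX =>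
    hF s hs (hsX.trans hX₁X₀) _ (hi s hs hsX).1
  obtain ⟨X₂, hX₂X₁, hX₂, hle | hnle⟩ :=
    hB.exists_homogeneous_pairs hX₁B hX₁ fun s t => i s ≤ i t
  swap
  · obtain ⟨s, hs, t, ht, hsX, htX, hst, h⟩ := hJ X₂ (hX₂X₁.trans hX₁B) hX₂ i
      fun s hs hsX => (hFi s hs (hsX.trans hX₂X₁)).1
    exact hnle s hs t ht hsX htX hst h
  obtain ⟨X, hXX₂, hX, heq | hne⟩ :=
    hB.exists_homogeneous_pairs (hX₂X₁.trans hX₁B) hX₂ fun s t => i s = i t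
  · -- The index is constant: the values there form a bad array in one factor.
    have hXX₁ := hXX₂.trans hX₂X₁
    have hconst : ∀ s ∈ B, ↑s ⊆ X → i s = i (barrierFront B X) := fun s hs hsX =>
      hB.eq_of_forall_shiftExtends (hXX₁.trans hX₁B) hX i heq hs hsX
    obtain ⟨s, hs, t, ht, hsX, htX, hst, h⟩ := hQ (i (barrierFront B X)) X (hXX₁.trans hX₁B) hX
      (fun s => (F s).1 (i (barrierFront B X))) fun s hs hsX => by
        rw [← hconst s hs hsX]
        exact (hFi s hs (hsX.trans hXX₁)).2
    refine ((hi s hs (hsX.trans hXX₁)).2 t ht (htX.trans hXX₁) hst).2 ?_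
    rw [hconst s hs hsX]
    exact h
  · -- The index increases strictly along the fronts `u 0 ◁ u 1 ◁ …` of the iterated tails of `X`,
    -- and all these indices lie in the support of `F (u 0)`.
    have hXX₁ := hXX₂.trans hX₂X₁
    let T : ℕ → Set ℕ := fun n => setTail^[n] X
    have hTs : ∀ n, T (n + 1) = setTail (T n) := fun n => Function.iterate_succ_apply' _ _ _
    have hT : ∀ n, T n ⊆ X ∧ (T n).Infinite := by
      intro n
      induction n with
      | zero => exact ⟨subset_rfl, hX⟩
      | succ n ih =>
        rw [hTs]
        exact ⟨(setTail_subset _).trans ih.1, ih.2.setTail⟩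
    have hTB : ∀ n, T n ⊆ barrierBase B := fun n => (hT n).1.trans (hXX₁.trans hX₁B)
    let u : ℕ → Finset ℕ := fun n => barrierFront B (T n)
    have hu : ∀ n, u n ∈ B := fun n => (hB.barrierFront_spec (hTB n) (hT n).2).1
    have huX : ∀ n, ↑(u n) ⊆ X := fun n =>
      (hB.barrierFront_subset (hTB n) (hT n).2).trans (hT n).1
    have hshift : ∀ n, ShiftExtends (u n) (u (n + 1)) := by
      intro n
      have h := hB.shiftExtends_barrierFront (hTB n) (hT n).2
      rw [← hTs] at h
      exact h
    have hmono : StrictMono fun n => i (u n) := strictMono_nat_of_lt_succ fun n =>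
      lt_of_le_of_ne (hle _ (hu n) _ (hu (n + 1)) ((huX n).trans hXX₂)
        ((huX (n + 1)).trans hXX₂) (hshift n))
        (hne _ (hu n) _ (hu (n + 1)) (huX n) (huX (n + 1)) (hshift n))
    have hval : ∀ n, ∀ m ≤ n, (F (u m)).1 (i (u n)) = (F (u n)).1 (i (u n)) := by
      intro n m hmn
      induction hmn using Nat.decreasingInduction with
      | self => rfl
      | of_succ m hm ih =>
        rw [← ih]
        exact ((hi _ (hu m) ((huX m).trans hXX₁)).2 _ (hu (m + 1)) ((huX (m + 1)).trans hXX₁)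
          (hshift m)).1 _ (hmono hm)
    refine Set.infinite_of_injective_forall_mem hmono.injective (fun n => ?_) (F (u 0)).2
    change (F (u 0)).1 (i (u n)) ≠ ⊥
    rw [hval n 0 (Nat.zero_le n)]
    exact (hi _ (hu n) ((huX n).trans hXX₁)).1

theorem isAlphaWqo {α : Ordinal.{0}} (hI : IsAlphaWqo α I) (hP : ∀ i, IsAlphaWqo α (P i)) :
    IsAlphaWqo α (DressSchiffels P) := by
  intro B hB hα f
  have h : IsWqoAlong B (restrict (P := P) Set.univ fun _ => Set.univ) :=
    isWqoAlong_restrict hB (hI.isWqoAlong hB hα id (fun _ _ h => h) (by simp))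
      fun i => (hP i).isWqoAlong hB hα id (fun _ _ h => h) (by simp)
  rw [restrict_univ] at h
  exact h.isGoodArray hB id (fun _ _ h => h) (fun _ => trivial) f

end DressSchiffels

/-! ### The barrier of singletons -/

/-- The barrier of all singletons; arrays along it are the infinite sequences. -/
def singletonBarrier : Set (Finset ℕ) := Set.range fun n => {n}

theorem isBarrier_singletonBarrier : IsBarrier singletonBarrier where
  infinite := Set.infinite_range_of_injective Finset.singleton_injective
  antichain := by
    rintro _ ⟨m, rfl⟩ _ ⟨n, rfl⟩ hne h
    exact hne (by simpa using h)
  exists_initial X _ hX := ⟨{sInf X}, ⟨_, rfl⟩, by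
    simpa using Nat.sInf_mem hX.nonempty, fun x hx y hy hxy => by
      rw [Finset.mem_singleton] at hy ⊢
      exact le_antisymm (hxy.trans_eq hy) (Nat.sInf_le hx)⟩

theorem shiftExtends_singleton {m n : ℕ} :
    ShiftExtends {m} {n} ↔ m < n := by
  simp [ShiftExtends, IsInitialSegment]

theorem barrierBase_singletonBarrier : barrierBase singletonBarrier = Set.univ :=
  Set.eq_univ_of_forall fun n => ⟨{n}, ⟨n, rfl⟩, Finset.mem_singleton_self n⟩

theorem isWqoAlong_singletonBarrier {Q : Type*} [LE Q] :
    IsWqoAlong singletonBarrier (Set.univ : Set Q) ↔ WellQuasiOrderedLE Q := by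
  refine ⟨fun h => ⟨fun f => ?_⟩, fun h X _ hX f _ => ?_⟩
  · obtain ⟨_, ⟨m, rfl⟩, _, ⟨n, rfl⟩, -, -, hmn, hle⟩ := h Set.univ
      barrierBase_singletonBarrier.ge Set.infinite_univ (fun s => f (s.sup id))
      fun _ _ _ => trivial
    exact ⟨m, n, shiftExtends_singleton.1 hmn, by simpa using hle⟩
  · obtain ⟨m, n, hmn, hle⟩ := h.wqo fun n => f {Nat.nth (· ∈ X) n}
    refine ⟨_, ⟨_, rfl⟩, _, ⟨_, rfl⟩, ?_, ?_, shiftExtends_singleton.2 ?_, hle⟩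
    · rw [Finset.coe_singleton, Set.singleton_subset_iff]
      exact Nat.nth_mem_of_infinite hX m
    · rw [Finset.coe_singleton, Set.singleton_subset_iff]
      exact Nat.nth_mem_of_infinite hX n
    · exact Nat.nth_strictMono hX hmn

namespace DressSchiffels

variable {I : Type*} [PartialOrder I] {P : I → Type*} [∀ i, PartialOrder (P i)]
  [∀ i, OrderBot (P i)]

theorem wellQuasiOrderedLE (hI : WellQuasiOrderedLE I) (hP : ∀ i, WellQuasiOrderedLE (P i)) :
    WellQuasiOrderedLE (DressSchiffels P) := by
  rw [← isWqoAlong_singletonBarrier, ← restrict_univ]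
  exact isWqoAlong_restrict isBarrier_singletonBarrier (isWqoAlong_singletonBarrier.2 hI)
    fun i => isWqoAlong_singletonBarrier.2 (hP i)

theorem isSigmaBqo (hI : IsSigmaBqo I) (hP : ∀ i, IsSigmaBqo (P i)) :
    IsSigmaBqo (DressSchiffels P) := by
  refine ⟨wellQuasiOrderedLE hI.1 fun i => (hP i).1, ?_⟩
  obtain ⟨-, S, hS, hSb⟩ := hI
  choose _ S' hS' hSb' using hP
  refine ⟨fun n => restrict (⋃ m ≤ n, S m) fun i => ⋃ m ≤ n, S' i m, ?_, fun n => ?_⟩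
  · refine Set.eq_univ_of_forall fun f => ?_
    have h1 : ∀ i, ∃ n, i ∈ S n := fun i => Set.mem_iUnion.1 (hS ▸ Set.mem_univ i)
    have h2 : ∀ i, ∃ n, f.1 i ∈ S' i n := fun i =>
      Set.mem_iUnion.1 (hS' i ▸ Set.mem_univ (f.1 i))
    choose a ha using h1
    choose b hb using h2
    -- The support is finite, so the levels of its indices and of the values there are bounded.
    refine Set.mem_iUnion.2 ⟨f.2.toFinset.sup a + f.2.toFinset.sup b, fun i hi => ?_⟩
    have hi' : i ∈ f.2.toFinset := f.2.mem_toFinset.2 hi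
    exact ⟨Set.mem_iUnion₂.2 ⟨a i, (Finset.le_sup hi').trans (Nat.le_add_right _ _), ha i⟩,
      Set.mem_iUnion₂.2 ⟨b i, (Finset.le_sup hi').trans (Nat.le_add_left _ _), hb i⟩⟩
  · rw [isBqo_iff_isWqoAlong]
    intro B hB
    exact isWqoAlong_restrict hB
      (IsWqoAlong.biUnion_le hB (fun m => (isBqo_iff_isWqoAlong _).1 (hSb m) B hB) n)
      fun i => IsWqoAlong.biUnion_le hB (fun m => (isBqo_iff_isWqoAlong _).1 (hSb' i m) B hB) n

end DressSchiffels

theorem mainTheorem1 {I : Type*} [PartialOrder I] (P : I → Type*) [∀ i, PartialOrder (P i)]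
    [∀ i, OrderBot (P i)] :
    (IsBqo I → (∀ i, IsBqo (P i)) → IsBqo (DressSchiffels P)) ∧
    (∀ α : Ordinal.{0}, ω ≤ α → α < ω₁ →
      IsAlphaWqo α I → (∀ i, IsAlphaWqo α (P i)) → IsAlphaWqo α (DressSchiffels P)) ∧
    (IsSigmaBqo I → (∀ i, IsSigmaBqo (P i)) → IsSigmaBqo (DressSchiffels P)) :=
  ⟨fun hI hP α hα => DressSchiffels.isAlphaWqo (hI α hα) fun i => hP i α hα,
    fun _ _ _ hI hP => DressSchiffels.isAlphaWqo hI hP,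
    DressSchiffels.isSigmaBqo⟩
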